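/- Let $G$ be a locally compact group with identity $e$. Let $C(G)$ be the Banach space of bounded continuous functions $f\colon G\to\mathbb{C}$ with the sup norm, and let $C_0(G)\subset C(G)$ be the set of functions vanishing at infinity. For $f\in C(G)$ let $O(f)=\{\,{}_xf_y : x,y\in G\,\}\subset C(G)$, where ${}_xf_y(z)=f(xzy)$ for $z\in G$, be the double orbit of $f$. Put $$WS(G)=\{f\in C(G): O(f)\text{ is relatively compact in the weak topology of the Banach space } C(G)\},$$ $$UCS(G)=\{f\in C(G): O(f)\text{ is equicontinuous on } G\}.$$ Call $G$ an IN-group if $e$ has a compact neighborhood $U$ that is invariant under all inner automorphisms, i.e. $xUx^{-1}\subset U$ for all $x\in G$. Then the following three conditions are equivalent: 1. $G$ is an IN-group; 2. $C_0(G)\cap WS(G)\neq\{0\}$; 3. $C_0(G)\cap UCS(G)\neq\{0\}$. -/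

import Mathlib

open scoped Topology BoundedContinuousFunction

/-- The two-sided translate `z ↦ f (x z y)` of a bounded continuous function `f` on `G`. -/
noncomputable def twoSidedTranslate {G : Type*} [Group G] [TopologicalSpace G] [IsTopologicalGroup G]
    (x y : G) (f : G →ᵇ ℂ) : G →ᵇ ℂ :=
  f.compContinuous ⟨fun z => x * z * y, by fun_prop⟩

/-- The double orbit `O(f)`: the set of all two-sided translates of `f`. -/
def doubleOrbit {G : Type*} [Group G] [TopologicalSpace G] [IsTopologicalGroup G]
    (f : G →ᵇ ℂ) : Set (G →ᵇ ℂ) :=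
  {g | ∃ x y : G, g = twoSidedTranslate x y f}

/-- `S` is relatively weakly compact in the normed space `E`: its closure in the weak topology
of `E` is weakly compact. -/
def IsRelativelyWeaklyCompact {E : Type*} [NormedAddCommGroup E] [NormedSpace ℂ E]
    (S : Set E) : Prop :=
  IsCompact (closure (toWeakSpace ℂ E '' S))

/-- `C₀(G)`, as a subset of the bounded continuous functions with the sup norm. -/
def C0 (G : Type*) [TopologicalSpace G] : Set (G →ᵇ ℂ) :=
  {f | Filter.Tendsto f (Filter.cocompact G) (𝓝 0)}

/-- `WS(G)`: the strictly weakly almost periodic functions. -/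
def WS (G : Type*) [Group G] [TopologicalSpace G] [IsTopologicalGroup G] : Set (G →ᵇ ℂ) :=
  {f | IsRelativelyWeaklyCompact (doubleOrbit f)}

/-- `UCS(G)`: the strictly uniformly continuous functions. -/
def UCS (G : Type*) [Group G] [TopologicalSpace G] [IsTopologicalGroup G] : Set (G →ᵇ ℂ) :=
  {f | Equicontinuous fun g : doubleOrbit f => ((g : G →ᵇ ℂ) : G → ℂ)}

/-- `G` is an IN-group: the identity has a compact neighborhood invariant under all inner
automorphisms. -/
def IsINGroup (G : Type*) [Group G] [TopologicalSpace G] : Prop :=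
  ∃ U ∈ 𝓝 (1 : G), IsCompact U ∧ ∀ x : G, ∀ u ∈ U, x * u * x⁻¹ ∈ U

/-!
The implication from equicontinuity to the IN-property is a direct compactness argument: if
`f c ≠ 0`, `f` vanishes at infinity and its two-sided translates are equicontinuous, then the
elements `u` such that `‖f (x u x⁻¹ c)‖ ≥ ‖f c‖ / 2` for all `x` form an invariant compact
neighborhood of the identity (`isINGroup_of_mem_C0_of_mem_UCS`).

Conversely, if `U` is a closed compact invariant neighborhood of the identity and `μ` is a Haar
measure, then conjugation preserves `μ` (on relatively compact sets), because it is multiplied by a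
constant which is `1` on `U`. So `f a = μ (U ∩ a U)` is a compactly supported continuous class
function, and it has equicontinuous double orbit (`IsINGroup.exists_classFunction`). Its double
orbit consists of its left translates, which depend norm continuously on the translation parameter
and tend weakly to `0` at infinity: a functional that stays large along translates escaping to
infinity would be unbounded on sums of translates with disjoint supports. Hence the orbit together
with `0` is weakly compact (`mem_WS_of_classFunction`).

It remains to see that `WS G ⊆ UCS G` (`WS_subset_UCS`), a Namioka-type statement. If the double
orbit is not equicontinuous then, by homogeneity, it oscillates by at least some `ε > 0` on every
nonempty open set. This yields a Cantor tree of compact sets whose uncountably many branches are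
separated by a countable subset `D` of the orbit. But the weak closure `K` of `D` is compact and,
lying in a separable subspace, metrizable, so that `C(K)` is separable and cannot contain
uncountably many separated point evaluations
(`countable_of_separated_of_isRelativelyWeaklyCompact`).
-/

open Filter Set MeasureTheory
open scoped Pointwise ENNReal

/-! ### Class functions on IN-groups from Haar measure -/

section HaarOverlap

variable {G : Type*} [Group G] [TopologicalSpace G] [IsTopologicalGroup G] [LocallyCompactSpace G]

/-- Right translation by `g` preserves the measure of relatively compact sets as soon as there is
one relatively compact set of positive measure whose measure it preserves. -/
theorem measure_preimage_mul_right_eq_of_isCompact [MeasurableSpace G] [BorelSpace G]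
    (μ : Measure G) [μ.IsHaarMeasure] {U A : Set G} (hU : IsCompact U)
    (hUpos : μ U ≠ 0) (hA : IsCompact A) (g : G)
    (h : μ ((· * g) ⁻¹' U) = μ U) : μ ((· * g) ⁻¹' A) = μ A := by
  have key (s : Set G) (hs : IsCompact s) :
      μ ((· * g) ⁻¹' s) = (Measure.map (· * g) μ).haarScalarFactor μ • μ s := by
    rw [← Measure.measure_isMulInvariant_eq_smul_of_isCompact_closure _ μ hs.closure]
    exact ((Homeomorph.mulRight g).toMeasurableEquiv.map_apply s).symm
  have hc : (Measure.map (· * g) μ).haarScalarFactor μ = 1 := by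
    have h1 := key U hU
    rw [h, ENNReal.smul_def, smul_eq_mul] at h1
    have h2 : ((Measure.map (· * g) μ).haarScalarFactor μ : ℝ≥0∞) * μ U = 1 * μ U := by
      rw [← h1, one_mul]
    have := (ENNReal.mul_left_inj hUpos hU.measure_ne_top).1 h2
    exact_mod_cast this
  rw [key A hA, hc, one_smul]

/-- An IN-group carries a nonzero compactly supported continuous class function whose two-sided
translates are equicontinuous, namely `a ↦ μ (U ∩ a U)` for a Haar measure `μ` and a closed compact
invariant neighborhood `U` of the identity. -/
theorem IsINGroup.exists_classFunction (hG : IsINGroup G) :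
    ∃ f : G →ᵇ ℂ, f ≠ 0 ∧ (∀ x y, f (x * y) = f (y * x)) ∧
      (∃ K, IsCompact K ∧ ∀ z ∉ K, f z = 0) ∧ f ∈ UCS G := by
  obtain ⟨U, hU1, hUc, hUinv, hUcl⟩ : ∃ U ∈ 𝓝 (1 : G), IsCompact U ∧
      (∀ x : G, ∀ u ∈ U, x * u * x⁻¹ ∈ U) ∧ IsClosed U := by
    obtain ⟨U, hU1, hUc, hUinv⟩ := hG
    refine ⟨closure U, mem_of_superset hU1 subset_closure, hUc.closure, fun x u hu => ?_,
      isClosed_closure⟩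
    exact map_mem_closure (f := fun u => x * u * x⁻¹) (by fun_prop) hu (hUinv x)
  borelize G
  let μ : Measure G := Measure.haar
  have hUpos : μ U ≠ 0 := (Measure.measure_pos_of_mem_nhds μ hU1).ne'
  have hconj (g u : G) : g * u * g⁻¹ ∈ U ↔ u ∈ U := by
    refine ⟨fun h => ?_, hUinv g u⟩
    simpa [mul_assoc] using hUinv g⁻¹ _ h
  have hR (g : G) (A : Set G) (hA : IsCompact A) : μ ((· * g) ⁻¹' A) = μ A := by
    refine measure_preimage_mul_right_eq_of_isCompact μ hUc hUpos hA g ?_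
    rw [← measure_preimage_mul μ g⁻¹ ((· * g) ⁻¹' U)]
    congr 1
    ext u
    simpa using hconj g⁻¹ u
  have hsc (a : G) : IsCompact (a • U) := hUc.smul a
  have hscl (a : G) : IsClosed (a • U) := hUcl.smul a
  let m : G → ℝ := fun a => μ.real (U ∩ a • U)
  let d : G → ℝ := fun g => μ.real (g • U \ U)
  have hd : Tendsto d (𝓝 1) (𝓝 0) := by
    have := tendsto_measure_smul_sdiff_isCompact_isClosed (μ := μ) hUc hUcl
    exact (ENNReal.tendsto_toReal ENNReal.zero_ne_top).comp this
  have hmd (a b : G) : m a - m b ≤ d (b⁻¹ * a) := by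
    have h1 : d (b⁻¹ * a) = μ.real (a • U \ b • U) := by
      simp only [d, Measure.real]
      rw [← measure_smul μ b ((b⁻¹ * a) • U \ U), smul_set_sdiff, smul_smul, mul_inv_cancel_left]
    have hfin : μ ((U ∩ b • U) ∪ (a • U \ b • U)) ≠ ∞ :=
      ((hUc.union (hsc a)).measure_lt_top.trans_le' (measure_mono (by
        rintro z (hz | hz)
        exacts [Or.inl hz.1, Or.inr hz.1]))).ne
    have h2 : m a ≤ μ.real ((U ∩ b • U) ∪ (a • U \ b • U)) := by
      refine measureReal_mono ?_ hfin
      rintro z ⟨hz, hza⟩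
      by_cases hzb : z ∈ b • U
      exacts [Or.inl ⟨hz, hzb⟩, Or.inr ⟨hza, hzb⟩]
    have h3 := measureReal_union_le (μ := μ) (U ∩ b • U) (a • U \ b • U)
    rw [h1]
    linarith
  have hdist (a b : G) : dist (m a) (m b) ≤ d (b⁻¹ * a) + d (a⁻¹ * b) := by
    have h0 (g : G) : 0 ≤ d g := measureReal_nonneg
    rw [Real.dist_eq, abs_le]
    constructor <;> linarith [hmd a b, hmd b a, h0 (b⁻¹ * a), h0 (a⁻¹ * b)]
  have hdlim (b : G) : Tendsto (fun a => d (b⁻¹ * a) + d (a⁻¹ * b)) (𝓝 b) (𝓝 0) := by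
    have h1 : Tendsto (fun a => b⁻¹ * a) (𝓝 b) (𝓝 1) := by
      have : Continuous fun a => b⁻¹ * a := by fun_prop
      simpa using this.tendsto b
    have h2 : Tendsto (fun a => a⁻¹ * b) (𝓝 b) (𝓝 1) := by
      have : Continuous fun a => a⁻¹ * b := by fun_prop
      simpa using this.tendsto b
    simpa using (hd.comp h1).add (hd.comp h2)
  have hmcont : Continuous m := by
    refine continuous_iff_continuousAt.2 fun b => tendsto_iff_dist_tendsto_zero.2 ?_
    exact squeeze_zero (fun _ => dist_nonneg) (fun a => hdist a b) (hdlim b)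
  have hmconj (g a : G) : m (g * a * g⁻¹) = m a := by
    simp only [m, Measure.real]
    congr 1
    rw [← hR g _ (hUc.inter_right (hscl a)), ← measure_preimage_mul μ g]
    congr 1
    ext z
    simp only [mem_inter_iff, mem_preimage, mem_smul_set_iff_inv_smul_mem, smul_eq_mul]
    rw [← hconj g (z * g), ← hconj g (a⁻¹ * (z * g))]
    simp [mul_assoc]
  have hmcomm (x y : G) : m (x * y) = m (y * x) := by
    rw [← hmconj x (y * x)]
    simp [mul_assoc]
  have hmbdd (a : G) : ‖(m a : ℂ)‖ ≤ μ.real U := by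
    rw [Complex.norm_real, Real.norm_of_nonneg measureReal_nonneg]
    exact measureReal_mono inter_subset_left hUc.measure_ne_top
  let f : G →ᵇ ℂ := BoundedContinuousFunction.ofNormedAddCommGroup (fun a => (m a : ℂ))
    (by fun_prop) _ hmbdd
  have hf (a : G) : f a = m a := rfl
  refine ⟨f, fun h => ?_, fun x y => by rw [hf, hf, hmcomm], ⟨U * U⁻¹, hUc.mul hUc.inv, ?_⟩, ?_⟩
  · have h1 : f 1 = 0 := by rw [h]; rfl
    rw [hf, Complex.ofReal_eq_zero] at h1
    simp only [m, one_smul, inter_self] at h1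
    exact (ENNReal.toReal_pos hUpos hUc.measure_ne_top).ne' h1
  · intro z hz
    have : U ∩ z • U = ∅ := by
      refine eq_empty_of_forall_notMem ?_
      rintro _ ⟨hw, u, hu, rfl⟩
      exact hz ⟨z • u, hw, u⁻¹, by simpa using hu, by simp⟩
    simp [hf, m, this]
  · refine fun z₀ => Metric.equicontinuousAt_iff_right.2 fun ε hε => ?_
    filter_upwards [(hdlim z₀).eventually (gt_mem_nhds hε)] with z hz
    rintro ⟨_, x, y, rfl⟩
    have h (w : G) : twoSidedTranslate x y f w = (m (y * x * w) : ℂ) := by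
      change f (x * w * y) = _
      rw [hf, hmcomm, mul_assoc]
    change dist (twoSidedTranslate x y f z₀) (twoSidedTranslate x y f z) < ε
    rw [h, h, dist_comm, Complex.dist_eq, ← Complex.ofReal_sub, Complex.norm_real,
      ← dist_eq_norm]
    refine (hdist _ _).trans_lt ?_
    have e1 : (y * x * z₀)⁻¹ * (y * x * z) = z₀⁻¹ * z := by group
    have e2 : (y * x * z)⁻¹ * (y * x * z₀) = z⁻¹ * z₀ := by group
    rwa [e1, e2]

end HaarOverlap

/-! ### Convergence in the weak topology -/

section WeakTopology

/-- A map into a Banach space with its weak topology converges as soon as all its images under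
continuous functionals do. -/
theorem tendsto_toWeakSpace_of_forall {E α : Type*} [NormedAddCommGroup E] [NormedSpace ℂ E]
    {l : Filter α} {g : α → E} {x : E}
    (h : ∀ φ : StrongDual ℂ E, Tendsto (fun a => φ (g a)) l (𝓝 (φ x))) :
    Tendsto (fun a => toWeakSpace ℂ E (g a)) l (𝓝 (toWeakSpace ℂ E x)) := by
  have hi : Topology.IsInducing fun (k : WeakSpace ℂ E) (φ : StrongDual ℂ E) =>
      φ ((toWeakSpace ℂ E).symm k) := ⟨rfl⟩
  exact hi.tendsto_nhds_iff.2 (tendsto_pi_nhds.2 h)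

/-- Continuous functionals are weakly continuous. -/
theorem continuous_strongDual_toWeakSpace_symm {E : Type*} [NormedAddCommGroup E] [NormedSpace ℂ E]
    (φ : StrongDual ℂ E) : Continuous fun k : WeakSpace ℂ E => φ ((toWeakSpace ℂ E).symm k) :=
  WeakBilin.eval_continuous (topDualPairing ℂ E).flip φ

/-- Point evaluations are weakly continuous. -/
theorem continuous_toWeakSpace_symm_apply {X : Type*} [TopologicalSpace X] (x : X) :
    Continuous fun k : WeakSpace ℂ (X →ᵇ ℂ) => (toWeakSpace ℂ (X →ᵇ ℂ)).symm k x :=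
  continuous_strongDual_toWeakSpace_symm (BoundedContinuousFunction.evalCLM ℂ x)

end WeakTopology

/-! ### Weak compactness of the translates of a class function -/

section Translates

variable {G : Type*} [Group G] [TopologicalSpace G] [IsTopologicalGroup G]

@[simp]
theorem twoSidedTranslate_apply (x y : G) (f : G →ᵇ ℂ) (z : G) :
    twoSidedTranslate x y f z = f (x * z * y) := rfl

/-- If finitely many left translates of `f` have pairwise disjoint supports, then the values of a
functional on them are summable with a bound independent of their number: up to unimodular
coefficients, their sum is again bounded by `‖f‖`. -/
theorem sum_norm_apply_translate_le (f : G →ᵇ ℂ) (φ : StrongDual ℂ (G →ᵇ ℂ)) (A : Finset G)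
    (hA : ∀ z, ∀ a ∈ A, ∀ b ∈ A, f (a * z) ≠ 0 → f (b * z) ≠ 0 → a = b) :
    ∑ a ∈ A, ‖φ (twoSidedTranslate a 1 f)‖ ≤ ‖φ‖ * ‖f‖ := by
  have hc (w : ℂ) : ∃ c : ℂ, ‖c‖ ≤ 1 ∧ c * w = (‖w‖ : ℂ) := by
    rcases eq_or_ne w 0 with rfl | hw
    · exact ⟨0, by simp⟩
    · have hw' : (‖w‖ : ℂ) ≠ 0 := by simpa using hw
      refine ⟨‖w‖ / w, ?_, div_mul_cancel₀ _ hw⟩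
      rw [norm_div, Complex.norm_real, norm_norm, div_self (norm_ne_zero_iff.2 hw)]
  choose c hc1 hc2 using hc
  let u (a : G) : ℂ := c (φ (twoSidedTranslate a 1 f))
  have hnorm : ‖∑ a ∈ A, u a • twoSidedTranslate a 1 f‖ ≤ ‖f‖ := by
    refine (BoundedContinuousFunction.norm_le (norm_nonneg f)).2 fun z => ?_
    simp only [BoundedContinuousFunction.coe_sum, Finset.sum_apply,
      BoundedContinuousFunction.coe_smul, twoSidedTranslate_apply, mul_one, smul_eq_mul]
    by_cases h : ∃ a ∈ A, f (a * z) ≠ 0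
    · obtain ⟨a, ha, hz⟩ := h
      rw [Finset.sum_eq_single_of_mem a ha fun b hb hba => ?_]
      · rw [norm_mul]
        exact (mul_le_of_le_one_left (norm_nonneg _) (hc1 _)).trans (f.norm_coe_le_norm _)
      · by_contra h0
        exact hba (hA z b hb a ha (right_ne_zero_of_mul h0) hz)
    · push Not at h
      rw [Finset.sum_eq_zero fun a ha => by rw [h a ha, mul_zero], norm_zero]
      exact norm_nonneg f
  have hsum : φ (∑ a ∈ A, u a • twoSidedTranslate a 1 f) =
      ((∑ a ∈ A, ‖φ (twoSidedTranslate a 1 f)‖ : ℝ) : ℂ) := by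
    simp only [map_sum, map_smul, smul_eq_mul, u, hc2, Complex.ofReal_sum]
  calc ∑ a ∈ A, ‖φ (twoSidedTranslate a 1 f)‖
      = ‖φ (∑ a ∈ A, u a • twoSidedTranslate a 1 f)‖ := by
        rw [hsum, Complex.norm_real, Real.norm_of_nonneg (Finset.sum_nonneg fun _ _ =>
          norm_nonneg _)]
    _ ≤ ‖φ‖ * ‖∑ a ∈ A, u a • twoSidedTranslate a 1 f‖ := φ.le_opNorm _
    _ ≤ ‖φ‖ * ‖f‖ := by gcongr

/-- The left translates `a ↦ f (a ·)` of a compactly supported function tend weakly to `0` at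
infinity: otherwise, arbitrarily many translates with disjoint supports would take values at least
`ε` under a given functional. -/
theorem tendsto_apply_translate_cocompact (f : G →ᵇ ℂ)
    (hf : ∃ K, IsCompact K ∧ ∀ z ∉ K, f z = 0) (φ : StrongDual ℂ (G →ᵇ ℂ)) :
    Tendsto (fun a => φ (twoSidedTranslate a 1 f)) (cocompact G) (𝓝 0) := by
  classical
  obtain ⟨K, hK, hfK⟩ := hf
  have hfK' {z : G} (hz : f z ≠ 0) : z ∈ K := by
    by_contra h
    exact hz (hfK z h)
  refine Metric.tendsto_nhds.2 fun ε hε => ?_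
  simp only [dist_zero_right]
  by_contra hfreq
  have hfar (T : Set G) (hT : IsCompact T) : ∃ b ∉ T, ε ≤ ‖φ (twoSidedTranslate b 1 f)‖ := by
    by_contra! h
    exact hfreq (mem_of_superset hT.compl_mem_cocompact h)
  have hfam (N : ℕ) : ∃ A : Finset G, A.card = N ∧
      (∀ a ∈ A, ε ≤ ‖φ (twoSidedTranslate a 1 f)‖) ∧
      ∀ z, ∀ a ∈ A, ∀ b ∈ A, f (a * z) ≠ 0 → f (b * z) ≠ 0 → a = b := by
    induction N with
    | zero => exact ⟨∅, by simp⟩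
    | succ N ih =>
      obtain ⟨A, hcard, hA, hdisj⟩ := ih
      -- outside of `T`, the support of the translate by `b` misses those of all translates by `A`
      let T : Set G := (A : Set G) ∪ K * K⁻¹ * (A : Set G)
      have hT : IsCompact T :=
        A.finite_toSet.isCompact.union ((hK.mul hK.inv).mul A.finite_toSet.isCompact)
      obtain ⟨b, hbT, hb⟩ := hfar T hT
      have hbA : b ∉ A := fun h => hbT (Or.inl h)
      have hmiss (z a : G) (ha : a ∈ A) (haz : f (a * z) ≠ 0) (hbz : f (b * z) ≠ 0) : False := by
        refine hbT (Or.inr ?_)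
        refine ⟨(b * z) * (a * z)⁻¹, mul_mem_mul (hfK' hbz) (inv_mem_inv.2 (hfK' haz)), a, ha, ?_⟩
        simp only
        group
      refine ⟨insert b A, by rw [Finset.card_insert_of_notMem hbA, hcard], ?_, ?_⟩
      · exact (Finset.forall_mem_insert _ _ _).2 ⟨hb, hA⟩
      · intro z a ha a' ha' haz haz'
        rcases Finset.mem_insert.1 ha with rfl | hmem <;>
          rcases Finset.mem_insert.1 ha' with rfl | hmem'
        · rfl
        · exact (hmiss z a' hmem' haz' haz).elim
        · exact (hmiss z a hmem haz haz').elim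
        · exact hdisj z a hmem a' hmem' haz haz'
  obtain ⟨N, hN⟩ := exists_nat_gt (‖φ‖ * ‖f‖ / ε)
  obtain ⟨A, rfl, hA, hdisj⟩ := hfam N
  have h1 := sum_norm_apply_translate_le f φ A hdisj
  have h2 := Finset.card_nsmul_le_sum A _ ε hA
  rw [nsmul_eq_mul] at h2
  rw [div_lt_iff₀ hε] at hN
  linarith

/-- A compactly supported class function with equicontinuous double orbit has relatively weakly
compact double orbit: together with `0`, the orbit is the image of the one-point compactification
of `G` under a weakly continuous map. -/
theorem mem_WS_of_classFunction (f : G →ᵇ ℂ) (hcomm : ∀ x y, f (x * y) = f (y * x))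
    (hf : ∃ K, IsCompact K ∧ ∀ z ∉ K, f z = 0) (hucs : f ∈ UCS G) : f ∈ WS G := by
  have horbit (x y : G) : twoSidedTranslate x y f = twoSidedTranslate (y * x) 1 f := by
    ext z
    rw [twoSidedTranslate_apply, hcomm, twoSidedTranslate_apply, mul_one, mul_assoc]
  have hcont : Continuous fun a : G => twoSidedTranslate a 1 f := by
    refine continuous_iff_continuousAt.2 fun a => Metric.tendsto_nhds.2 fun ε hε => ?_
    filter_upwards [Metric.equicontinuousAt_iff_right.1 (hucs a) (ε / 2) (half_pos hε)] with b hb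
    refine ((BoundedContinuousFunction.dist_le (half_pos hε).le).2 fun z => ?_).trans_lt
      (half_lt_self hε)
    have := (hb ⟨_, 1, z, rfl⟩).le
    simpa [dist_comm] using this
  let F : OnePoint G → WeakSpace ℂ (G →ᵇ ℂ) := fun p =>
    toWeakSpace ℂ _ (p.elim 0 fun a => twoSidedTranslate a 1 f)
  have hF : Continuous F := by
    refine (OnePoint.continuous_iff F).2 ⟨?_, ?_⟩
    · refine tendsto_toWeakSpace_of_forall fun φ => ?_
      rw [OnePoint.elim_infty, map_zero]
      rw [Filter.coclosedCompact_eq_cocompact]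
      exact tendsto_apply_translate_cocompact f hf φ
    · exact (toWeakSpaceCLM ℂ (G →ᵇ ℂ)).continuous.comp hcont
  refine (isCompact_range hF).closure_of_subset ?_
  rintro _ ⟨_, ⟨x, y, rfl⟩, rfl⟩
  exact ⟨((y * x : G) : OnePoint G), by rw [horbit]; rfl⟩

/-! ### From equicontinuity to an invariant neighborhood -/

/-- A nonzero function in `C₀(G)` with equicontinuous double orbit makes `G` an IN-group: if
`f c ≠ 0` then the elements all of whose conjugates `v` satisfy `‖f (v * c)‖ ≥ ‖f c‖ / 2` form an
invariant compact neighborhood of the identity. -/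
theorem isINGroup_of_mem_C0_of_mem_UCS {f : G →ᵇ ℂ} (hf0 : f ≠ 0) (hC0 : f ∈ C0 G)
    (hucs : f ∈ UCS G) : IsINGroup G := by
  obtain ⟨c, hc⟩ : ∃ c, f c ≠ 0 := by
    by_contra! h
    exact hf0 (BoundedContinuousFunction.ext h)
  have hε : 0 < ‖f c‖ / 2 := by positivity
  let W : Set G := {z | ‖f c‖ / 2 ≤ ‖f (z * c)‖}
  have hWcl : IsClosed W := isClosed_le continuous_const (by fun_prop)
  obtain ⟨K, hK, hKf⟩ := mem_cocompact.1 ((Metric.tendsto_nhds.1 hC0) _ hε)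
  have hWK : W ⊆ (· * c⁻¹) '' K := by
    intro z hz
    refine ⟨z * c, ?_, by simp⟩
    by_contra h
    have := hKf h
    simp only [dist_zero_right, mem_ofPred_eq] at this
    exact absurd hz (not_le.2 this)
  have hWc : IsCompact W :=
    (hK.image (continuous_mul_const c⁻¹)).of_isClosed_subset hWcl hWK
  refine ⟨⋂ x : G, (fun u => x * u * x⁻¹) ⁻¹' W, ?_, ?_, ?_⟩
  · filter_upwards [Metric.equicontinuousAt_iff_right.1 (hucs 1) _ hε] with v hv
    refine mem_iInter.2 fun x => ?_
    have h : dist (f (x * 1 * (x⁻¹ * c))) (f (x * v * (x⁻¹ * c))) < ‖f c‖ / 2 :=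
      hv ⟨_, x, x⁻¹ * c, rfl⟩
    rw [mul_one, mul_inv_cancel_left, ← mul_assoc, dist_eq_norm] at h
    have := norm_sub_norm_le (f c) (f (x * v * x⁻¹ * c))
    change ‖f c‖ / 2 ≤ ‖f (x * v * x⁻¹ * c)‖
    linarith
  · refine hWc.of_isClosed_subset (isClosed_iInter fun x => hWcl.preimage (by fun_prop)) ?_
    intro u hu
    simpa using mem_iInter.1 hu 1
  · intro x u hu
    refine mem_iInter.2 fun y => ?_
    have := mem_iInter.1 hu (y * x)
    simpa [mul_assoc] using this

end Translates

/-! ### Countable weakly compact families separate countably many points -/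

section WeaklyCompact

open TopologicalSpace

/-- The weak closure of a countable relatively weakly compact set of bounded continuous functions
is second countable: it lies in a norm-separable subspace, on which countably many point
evaluations separate points, so by compactness these evaluations embed it into a countable power
of `ℂ`. -/
theorem secondCountableTopology_weakClosure {X : Type*} [TopologicalSpace X] [Nonempty X]
    {D : Set (X →ᵇ ℂ)} (hD : D.Countable) (hc : IsRelativelyWeaklyCompact D) :
    SecondCountableTopology (closure (toWeakSpace ℂ (X →ᵇ ℂ) '' D)) := by
  let E : Submodule ℂ (X →ᵇ ℂ) := (Submodule.span ℂ D).topologicalClosure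
  have hEsep : IsSeparable (E : Set (X →ᵇ ℂ)) := (hD.isSeparable.span (R := ℂ)).closure
  obtain ⟨t, -, htc, hEt⟩ := hEsep.exists_countable_dense_subset
  have hpt (d : X →ᵇ ℂ) : ∃ z, ‖d‖ ≤ 2 * ‖d z‖ := by
    by_contra! h
    obtain ⟨z⟩ := ‹Nonempty X›
    have h1 : ‖d‖ ≤ ‖d‖ / 2 :=
      (BoundedContinuousFunction.norm_le (by positivity)).2 fun z => by linarith [h z]
    linarith [h z, norm_nonneg (d z)]
  choose z hz using hpt
  have hsub : closure (toWeakSpace ℂ (X →ᵇ ℂ) '' D) ⊆ toWeakSpace ℂ (X →ᵇ ℂ) '' E := by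
    have hconv : Convex ℝ (Submodule.span ℂ D : Set (X →ᵇ ℂ)) :=
      ((Submodule.span ℂ D).restrictScalars ℝ).convex
    have hE : toWeakSpace ℂ (X →ᵇ ℂ) '' E =
        closure (toWeakSpace ℂ (X →ᵇ ℂ) '' (Submodule.span ℂ D : Set (X →ᵇ ℂ))) :=
      hconv.toWeakSpace_closure (𝕜 := ℂ)
    rw [hE]
    exact closure_mono (image_mono Submodule.subset_span)
  have hzero (e : X →ᵇ ℂ) (he : e ∈ E) (h0 : ∀ d ∈ t, e (z d) = 0) : e = 0 := by
    by_contra hne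
    have hpos : 0 < ‖e‖ := norm_pos_iff.2 hne
    obtain ⟨d, hdt, hd⟩ := Metric.mem_closure_iff.1 (hEt he) (‖e‖ / 3) (by positivity)
    have h1 : ‖d (z d)‖ ≤ ‖e - d‖ := by
      have := (e - d).norm_coe_le_norm (z d)
      simpa [h0 d hdt] using this
    rw [dist_eq_norm] at hd
    have h2 : ‖e‖ ≤ ‖e - d‖ + ‖d‖ := by simpa using norm_add_le (e - d) d
    linarith [hz d]
  have : Countable t := htc.to_subtype
  have : CompactSpace (closure (toWeakSpace ℂ (X →ᵇ ℂ) '' D)) := isCompact_iff_compactSpace.1 hc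
  let F : closure (toWeakSpace ℂ (X →ᵇ ℂ) '' D) → t → ℂ :=
    fun k d => (toWeakSpace ℂ (X →ᵇ ℂ)).symm k.1 (z d)
  have hF : Continuous F := continuous_pi fun d =>
    (continuous_toWeakSpace_symm_apply (z d)).comp continuous_subtype_val
  have hFinj : Function.Injective F := by
    rintro ⟨k, hk⟩ ⟨l, hl⟩ hkl
    obtain ⟨k, hkE, rfl⟩ := hsub hk
    obtain ⟨l, hlE, rfl⟩ := hsub hl
    have : k - l = 0 := hzero _ (E.sub_mem hkE hlE) fun d hd => sub_eq_zero.2 (congrFun hkl ⟨d, hd⟩)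
    simp only [sub_eq_zero.1 this]
  exact (hF.isClosedEmbedding hFinj).isEmbedding.secondCountableTopology

/-- A countable relatively weakly compact set `D` of bounded continuous functions can `ε`-separate
only countably many points: evaluation embeds those points as an `ε`-separated family in the
separable space of continuous functions on the weak closure of `D`. -/
theorem countable_of_separated_of_isRelativelyWeaklyCompact {X ι : Type*} [TopologicalSpace X]
    {D : Set (X →ᵇ ℂ)} (hD : D.Countable) (hc : IsRelativelyWeaklyCompact D) {ε : ℝ} (hε : 0 < ε)
    (v : ι → X) (hv : Pairwise fun i j => ∃ k ∈ D, ε ≤ dist (k (v i)) (k (v j))) :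
    Countable ι := by
  rcases isEmpty_or_nonempty X with hX | hX
  · have : IsEmpty ι := v.isEmpty
    infer_instance
  have := secondCountableTopology_weakClosure hD hc
  have : CompactSpace (closure (toWeakSpace ℂ (X →ᵇ ℂ) '' D)) := isCompact_iff_compactSpace.1 hc
  let ev (x : X) : C(closure (toWeakSpace ℂ (X →ᵇ ℂ) '' D), ℂ) :=
    ⟨fun k => (toWeakSpace ℂ (X →ᵇ ℂ)).symm k.1 x,
      (continuous_toWeakSpace_symm_apply x).comp continuous_subtype_val⟩
  refine Pairwise.countable_of_isOpen_disjoint (s := fun i => Metric.ball (ev (v i)) (ε / 2))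
    (fun i j hij => ?_) (fun _ => Metric.isOpen_ball) fun i => ⟨ev (v i), by simp [hε]⟩
  obtain ⟨k, hk, hdist⟩ := hv hij
  refine Metric.ball_disjoint_ball ?_
  rw [add_halves]
  exact hdist.trans (ContinuousMap.dist_apply_le_dist (f := ev (v i)) (g := ev (v j))
    ⟨toWeakSpace ℂ _ k, subset_closure (mem_image_of_mem _ hk)⟩)

end WeaklyCompact

/-! ### Weakly compact double orbits are equicontinuous -/

section Oscillation

variable {G : Type*} [Group G] [TopologicalSpace G] [IsTopologicalGroup G]

/-- If the double orbit of `f` is not equicontinuous at some point, then by translation its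
oscillation is bounded below on all nonempty open sets. -/
theorem exists_oscillation_of_notMem_UCS {f : G →ᵇ ℂ} (hf : f ∉ UCS G) :
    ∃ ε > 0, ∀ V : Set G, IsOpen V → V.Nonempty →
      ∃ k ∈ doubleOrbit f, ∃ a ∈ V, ∃ b ∈ V, ε ≤ dist (k a) (k b) := by
  have hf' : ¬ ∀ x₀, EquicontinuousAt (fun g : doubleOrbit f => ((g : G →ᵇ ℂ) : G → ℂ)) x₀ := hf
  push Not at hf'
  obtain ⟨x₀, hx₀⟩ := hf'
  rw [Metric.equicontinuousAt_iff_right] at hx₀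
  push Not at hx₀
  obtain ⟨ε, hε, hfreq⟩ := hx₀
  refine ⟨ε, hε, fun V hV ⟨u, hu⟩ => ?_⟩
  have hcont : Continuous fun z => u * x₀⁻¹ * z := by fun_prop
  have hnhds : ∀ᶠ z in 𝓝 x₀, u * x₀⁻¹ * z ∈ V :=
    hcont.continuousAt.eventually (by simpa using hV.mem_nhds hu)
  obtain ⟨z, ⟨⟨_, x, y, rfl⟩, hxy⟩, hz⟩ := (hfreq.and_eventually hnhds).exists
  refine ⟨_, ⟨x * x₀ * u⁻¹, y, rfl⟩, u, hu, _, hz, ?_⟩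
  simpa [mul_assoc] using hxy

variable [LocallyCompactSpace G]

/-- Strictly weakly almost periodic functions are strictly uniformly continuous. Otherwise a binary
tree of compact sets with nonempty interior can be built in which the two children of each node are
`ε`-separated by some function in the double orbit. These countably many functions then separate
the uncountably many branches of the tree. -/
theorem WS_subset_UCS : WS G ⊆ UCS G := by
  intro f hf
  by_contra hucs
  obtain ⟨ε, hε, hosc⟩ := exists_oscillation_of_notMem_UCS hucs
  let N := {C : Set G // IsCompact C ∧ IsClosed C ∧ (interior C).Nonempty}
  have hshrink {V : Set G} {x : G} (hV : V ∈ 𝓝 x) : ∃ C : N, C.1 ⊆ V := by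
    obtain ⟨C, ⟨hC, hCc, hCcl⟩, hCV⟩ := (isCompact_isClosed_basis_nhds x).mem_iff.1 hV
    exact ⟨⟨C, hCc, hCcl, x, mem_interior_iff_mem_nhds.2 hC⟩, hCV⟩
  have hsplit (C : N) : ∃ k ∈ doubleOrbit f, ∃ S : Bool → N, (∀ i, (S i).1 ⊆ C.1) ∧
      ∀ a ∈ (S false).1, ∀ b ∈ (S true).1, ε / 2 ≤ dist (k a) (k b) := by
    obtain ⟨k, hk, a, ha, b, hb, hab⟩ := hosc _ isOpen_interior C.2.2.2
    have hnear (x : G) (hx : x ∈ interior C.1) :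
        C.1 ∩ {z | dist (k z) (k x) < ε / 4} ∈ 𝓝 x := by
      refine inter_mem (mem_interior_iff_mem_nhds.1 hx) ?_
      exact k.continuous.continuousAt.eventually (Metric.ball_mem_nhds _ (by positivity))
    obtain ⟨A, hA⟩ := hshrink (hnear a ha)
    obtain ⟨B, hB⟩ := hshrink (hnear b hb)
    refine ⟨k, hk, fun i => if i then B else A, fun i => ?_, fun a' ha' b' hb' => ?_⟩
    · cases i
      exacts [fun z hz => (hA hz).1, fun z hz => (hB hz).1]
    · have h1 : dist (k a') (k a) < ε / 4 := (hA ha').2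
      have h2 : dist (k b') (k b) < ε / 4 := (hB hb').2
      have h3 := dist_triangle4 (k a) (k a') (k b') (k b)
      rw [dist_comm (k a) (k a')] at h3
      linarith
  choose k hk S hS hsep using hsplit
  obtain ⟨root, -⟩ := hshrink (univ_mem : univ ∈ 𝓝 (1 : G))
  let node (l : List Bool) : N := l.foldl S root
  let branch (σ : ℕ → Bool) (n : ℕ) : N := node ((List.range n).map σ)
  have hbranch (σ : ℕ → Bool) (n : ℕ) : branch σ (n + 1) = S (branch σ n) (σ n) := by
    simp [branch, node, List.range_succ]
  have hpoint (σ : ℕ → Bool) : ∃ v, ∀ n, v ∈ (branch σ n).1 := by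
    obtain ⟨v, hv⟩ := IsCompact.nonempty_iInter_of_sequence_nonempty_isCompact_isClosed
      (fun n => (branch σ n).1) (fun n => by rw [hbranch]; exact hS _ _)
      (fun n => (branch σ n).2.2.2.mono interior_subset) (branch σ 0).2.1
      (fun n => (branch σ n).2.2.1)
    exact ⟨v, mem_iInter.1 hv⟩
  choose v hv using hpoint
  let D : Set (G →ᵇ ℂ) := range fun l => k (node l)
  have hDsub : D ⊆ doubleOrbit f := by
    rintro _ ⟨l, rfl⟩
    exact hk _
  have hDc : IsRelativelyWeaklyCompact D :=
    IsCompact.of_isClosed_subset hf isClosed_closure (closure_mono (image_mono hDsub))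
  have hsepv : Pairwise fun σ τ => ∃ k ∈ D, ε / 2 ≤ dist (k (v σ)) (k (v τ)) := by
    intro σ τ hne
    -- the two branches agree up to the first index at which `σ` and `τ` differ
    have hex : ∃ n, σ n ≠ τ n := Function.ne_iff.1 hne
    classical
    let n := Nat.find hex
    have hn : σ n ≠ τ n := Nat.find_spec hex
    have heq : branch τ n = branch σ n := by
      refine congrArg node (List.map_congr_left fun i hi => ?_)
      exact (not_not.1 (Nat.find_min hex (List.mem_range.1 hi))).symm
    have hvσ := hv σ (n + 1)
    have hvτ := hv τ (n + 1)
    rw [hbranch] at hvσ hvτ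
    rw [heq] at hvτ
    refine ⟨k (branch σ n), mem_range_self _, ?_⟩
    rcases hσ : σ n with _ | _ <;> rcases hτ : τ n with _ | _ <;> rw [hσ] at hvσ <;>
      rw [hτ] at hvτ
    · exact (hn (hσ.trans hτ.symm)).elim
    · exact hsep _ _ hvσ _ hvτ
    · rw [dist_comm]
      exact hsep _ _ hvτ _ hvσ
    · exact (hn (hσ.trans hτ.symm)).elim
  have hcount : Countable (ℕ → Bool) :=
    countable_of_separated_of_isRelativelyWeaklyCompact (countable_range _) hDc (half_pos hε)
      v hsepv
  obtain ⟨e, he⟩ := exists_surjective_nat (ℕ → Bool)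
  obtain ⟨n, hn⟩ := he fun n => !e n n
  simpa using congrFun hn n

end Oscillation

/-! ### The equivalence -/

theorem proposition2p9 (G : Type*) [Group G] [TopologicalSpace G] [IsTopologicalGroup G]
    [LocallyCompactSpace G] :
    List.TFAE [IsINGroup G, C0 G ∩ WS G ≠ {0}, C0 G ∩ UCS G ≠ {0}] := by
  have hzeroC0 : (0 : G →ᵇ ℂ) ∈ C0 G := tendsto_const_nhds
  have hzeroWS : (0 : G →ᵇ ℂ) ∈ WS G := by
    refine (isCompact_singleton (x := toWeakSpace ℂ (G →ᵇ ℂ) 0)).closure_of_subset ?_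
    rintro _ ⟨_, ⟨x, y, rfl⟩, rfl⟩
    rfl
  have hne {S : Set (G →ᵇ ℂ)} (hS : 0 ∈ S) : S ≠ {0} ↔ ∃ f ∈ S, f ≠ 0 := by
    rw [Ne, eq_singleton_iff_unique_mem, not_and]
    push Not
    exact forall_prop_of_true hS
  rw [hne (S := C0 G ∩ WS G) ⟨hzeroC0, hzeroWS⟩,
    hne (S := C0 G ∩ UCS G) ⟨hzeroC0, WS_subset_UCS hzeroWS⟩]
  tfae_have 1 → 2 := by
    intro hG
    obtain ⟨f, hf0, hcomm, ⟨K, hK, hfK⟩, hucs⟩ := hG.exists_classFunction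
    refine ⟨f, ⟨?_, mem_WS_of_classFunction f hcomm ⟨K, hK, hfK⟩ hucs⟩, hf0⟩
    exact tendsto_const_nhds.congr' (mem_of_superset hK.compl_mem_cocompact fun z hz =>
      (hfK z hz).symm)
  tfae_have 2 → 3 := fun ⟨f, hf, hf0⟩ => ⟨f, ⟨hf.1, WS_subset_UCS hf.2⟩, hf0⟩
  tfae_have 3 → 1 := fun ⟨_, hf, hf0⟩ => isINGroup_of_mem_C0_of_mem_UCS hf0 hf.1 hf.2
  tfae_finish
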